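/- **Coproduct Preservation Theorem.** Let $\mathcal D$ be the category of bounded distributive lattices ($0=1$ allowed) and bound-preserving lattice homomorphisms, and let $\mathbf 2=\{0<1\}\in\mathcal D$. Let $\mathcal A$ be a finitely generated $\mathcal D$-based quasivariety, that is, a class of algebras in a fixed algebraic language such that $\mathcal A=\mathbb{ISP}(\mathcal M)$ (isomorphic copies of subalgebras of products, the empty product included) for some finite set $\mathcal M$ of finite algebras, and such that for certain binary terms $\wedge,\vee$ and closed terms $0,1$ of the language the reduct $(A,\wedge,\vee,0,1)$ of every $\mathbf A\in\mathcal A$ lies in $\mathcal D$. Regard $\mathcal A$ as a category with all homomorphisms as morphisms, and let $U\colon\mathcal A\to\mathcal D$ be the forgetful functor sending $\mathbf A$ to this reduct and each homomorphism to itself. Call $\mathbf B$ *subdirectly irreducible relative to $\mathcal A$* if $\mathbf B\in\mathcal A$ and, whenever $\mathbf B$ is isomorphic to a subdirect product of algebras in $\mathcal A$, it is isomorphic to at least one of the components. Sets of subalgebras are ordered by inclusion. Then the following are equivalent. (A) $U$ preserves coproducts: for every family (possibly empty) of algebras in $\mathcal A$ indexed by a set, $U$ sends its universal co-cone in $\mathcal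 A$ to a universal co-cone in $\mathcal D$. (B) Both of the following hold: - (i) there exist a finite algebra $\mathbf M\in\mathcal A$ and $\omega\in\mathcal D(U(\mathbf M),\mathbf 2)$ such that $\mathcal A=\mathbb{ISP}(\mathbf M)$ and, for all $a,b\in\mathbf M$, if $\omega(u(a))=\omega(u(b))$ for every endomorphism $u$ of $\mathbf M$, then $a=b$; - (ii) for every $\mathbf A\in\mathcal A$ and every sublattice $L$ of $U(\mathbf A)$ containing $0$ and $1$, the set of subalgebras $\mathbf C$ of $\mathbf A$ with $C\subseteq L$ is empty or has a top element. (C) There exist a finite algebra $\mathbf M\in\mathcal A$, subdirectly irreducible relative to $\mathcal A$, and $\omega\in\mathcal D(U(\mathbf M),\mathbf 2)$ such that - (i) every algebra that is subdirectly irreducible relative to $\mathcal A$ belongs to $\mathbb{IS}(\mathbf M)$; - (ii) for all $a,b\in\mathbf M$, if $\omega(u(a))=\omega(u(b))$ for every endomorphism $u$ of $\mathbf M$, then $a=b$; - (iii) the set of subalgebras $\mathbf C$ of $\mathbf M^2$ such that $\omega(c_1)\le\omega(c_2)$ for all $(c_1,c_2)\in\mathbf C$ has a top element. -/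

import Mathlib

open CategoryTheory
open scoped FirstOrder

universe u v w

namespace CoprodPres

/-- A (possibly empty-index) product of `L`-algebras, with coordinatewise operations. -/
instance piStructure {L : FirstOrder.Language.{u, v}} {ι : Type*} (B : ι → Type*)
    [∀ i, L.Structure (B i)] : L.Structure (∀ i, B i) where
  funMap f x := fun i => FirstOrder.Language.Structure.funMap f (fun j => x j i)
  RelMap r x := ∀ i, FirstOrder.Language.Structure.RelMap r (fun j => x j i)

/-- The binary product of `L`-algebras, with coordinatewise operations. -/
instance prodStructure {L : FirstOrder.Language.{u, v}} (A B : Type*) [L.Structure A] [L.Structure B] :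
    L.Structure (A × B) where
  funMap f x :=
    (FirstOrder.Language.Structure.funMap f (fun j => (x j).1), FirstOrder.Language.Structure.funMap f (fun j => (x j).2))
  RelMap r x :=
    FirstOrder.Language.Structure.RelMap r (fun j => (x j).1) ∧ FirstOrder.Language.Structure.RelMap r (fun j => (x j).2)

/-- A bundled algebra of the language `L` (used below only for languages without relation
symbols, that is, for algebraic languages). -/
structure Alg (L : FirstOrder.Language.{u, v}) where
  carrier : Type w
  [str : L.Structure carrier]

attribute [instance] Alg.str

instance {L : FirstOrder.Language.{u, v}} : CoeSort (Alg.{u, v, w} L) (Type w) := ⟨Alg.carrier⟩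

/-- The category of all `L`-algebras and homomorphisms. -/
instance {L : FirstOrder.Language.{u, v}} : Category (Alg.{u, v, w} L) where
  Hom A B := A →[L] B
  id A := FirstOrder.Language.Hom.id L A
  comp f g := g.comp f

/-- The class operator `I`: isomorphic copies of members of `𝒦`. -/
def opI {L : FirstOrder.Language.{u, v}} (𝒦 : ObjectProperty (Alg.{u, v, w} L)) :
    ObjectProperty (Alg.{u, v, w} L) :=
  fun A => ∃ B : Alg.{u, v, w} L, 𝒦 B ∧ Nonempty (A ≃[L] B)

/-- The class operator `S`: subalgebras of members of `𝒦`. -/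
def opS {L : FirstOrder.Language.{u, v}} (𝒦 : ObjectProperty (Alg.{u, v, w} L)) :
    ObjectProperty (Alg.{u, v, w} L) :=
  fun A => ∃ B : Alg.{u, v, w} L, 𝒦 B ∧ ∃ C : L.Substructure B, A = ⟨C⟩

/-- The class operator `P`: products of families of members of `𝒦` (the empty family, whose
product is the one-element algebra, included). -/
def opP {L : FirstOrder.Language.{u, v}} (𝒦 : ObjectProperty (Alg.{u, v, w} L)) :
    ObjectProperty (Alg.{u, v, w} L) :=
  fun A => ∃ (ι : Type w) (B : ι → Alg.{u, v, w} L), (∀ i, 𝒦 (B i)) ∧ A = ⟨∀ i, B i⟩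

/-- `ISP(𝓜)` for a set `𝓜` of algebras. -/
def ISP {L : FirstOrder.Language.{u, v}} (𝓜 : Set (Alg.{u, v, w} L)) : ObjectProperty (Alg.{u, v, w} L) :=
  opI (opS (opP (fun A => A ∈ 𝓜)))

/-- A finitely generated quasivariety: a class of the form `ISP(𝓜)` for some finite set `𝓜` of
finite algebras. -/
def IsFinitelyGeneratedQuasivariety {L : FirstOrder.Language.{u, v}}
    (𝒜 : ObjectProperty (Alg.{u, v, w} L)) : Prop :=
  ∃ 𝓜 : Set (Alg.{u, v, w} L), 𝓜.Finite ∧ (∀ M ∈ 𝓜, Finite M) ∧ 𝒜 = ISP 𝓜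

/-- A choice of `L`-terms `∧`, `∨` (binary) and `0`, `1` (closed); they may in particular be
basic operation symbols of `L`. -/
structure LatticeTerms (L : FirstOrder.Language.{u, v}) where
  meet : L.Term (Fin 2)
  join : L.Term (Fin 2)
  zero : L.Term Empty
  one : L.Term Empty

namespace LatticeTerms

variable {L : FirstOrder.Language.{u, v}} (τ : LatticeTerms L) (A : Type w) [L.Structure A]

/-- The binary operation `∧` interpreted in the algebra `A`. -/
def inf (a b : A) : A := τ.meet.realize ![a, b]

/-- The binary operation `∨` interpreted in the algebra `A`. -/
def sup (a b : A) : A := τ.join.realize ![a, b]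

/-- The constant `0` interpreted in the algebra `A`. -/
def bot : A := τ.zero.realize Empty.elim

/-- The constant `1` interpreted in the algebra `A`. -/
def top : A := τ.one.realize Empty.elim

/-- The reduct `(A, ∧, ∨, 0, 1)` is a bounded distributive lattice (`0 = 1` is allowed). -/
structure IsBoundedDistribLattice : Prop where
  sup_comm : ∀ a b : A, τ.sup A a b = τ.sup A b a
  sup_assoc : ∀ a b c : A, τ.sup A (τ.sup A a b) c = τ.sup A a (τ.sup A b c)
  inf_comm : ∀ a b : A, τ.inf A a b = τ.inf A b a
  inf_assoc : ∀ a b c : A, τ.inf A (τ.inf A a b) c = τ.inf A a (τ.inf A b c)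
  sup_inf_self : ∀ a b : A, τ.sup A a (τ.inf A a b) = a
  inf_sup_self : ∀ a b : A, τ.inf A a (τ.sup A a b) = a
  inf_sup_left : ∀ a b c : A, τ.inf A a (τ.sup A b c) = τ.sup A (τ.inf A a b) (τ.inf A a c)
  bot_sup : ∀ a : A, τ.sup A (τ.bot A) a = a
  sup_top : ∀ a : A, τ.sup A a (τ.top A) = τ.top A

variable {τ A}

/-- The lattice structure of the reduct; its order is `a ≤ b ↔ a ∨ b = b`. -/
@[reducible] def IsBoundedDistribLattice.lattice (h : τ.IsBoundedDistribLattice A) : Lattice A :=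
  letI : Max A := ⟨τ.sup A⟩
  letI : Min A := ⟨τ.inf A⟩
  Lattice.mk' h.sup_comm h.sup_assoc h.inf_comm h.inf_assoc h.sup_inf_self h.inf_sup_self

/-- The distributive lattice structure of the reduct. -/
@[reducible] def IsBoundedDistribLattice.distribLattice (h : τ.IsBoundedDistribLattice A) :
    DistribLattice A :=
  letI := h.lattice
  DistribLattice.ofInfSupLe fun a b c => le_of_eq (h.inf_sup_left a b c)

/-- The bounds of the reduct. -/
@[reducible] def IsBoundedDistribLattice.boundedOrder (h : τ.IsBoundedDistribLattice A) :
    letI := h.distribLattice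
    BoundedOrder A :=
  letI := h.distribLattice
  { bot := τ.bot A
    top := τ.top A
    bot_le := fun a => sup_eq_right.mp (h.bot_sup a)
    le_top := fun a => sup_eq_right.mp (h.sup_top a) }

/-- The reduct `(A, ∧, ∨, 0, 1)` as an object of the category of bounded distributive lattices. -/
def IsBoundedDistribLattice.reduct (h : τ.IsBoundedDistribLattice A) : BddDistLat.{w} :=
  letI := h.distribLattice
  letI := h.boundedOrder
  BddDistLat.of A

end LatticeTerms

/-- The class `𝒜` is `D`-based (via the terms `τ`): the reduct of each of its members is a
bounded distributive lattice. -/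
def IsDBased {L : FirstOrder.Language.{u, v}} (τ : LatticeTerms L) (𝒜 : ObjectProperty (Alg.{u, v, w} L)) :
    Prop :=
  ∀ A : Alg.{u, v, w} L, 𝒜 A → τ.IsBoundedDistribLattice A

theorem map_inf {L : FirstOrder.Language.{u, v}} (τ : LatticeTerms L) {A B : Type w} [L.Structure A]
    [L.Structure B] (f : A →[L] B) (a b : A) : f (τ.inf A a b) = τ.inf B (f a) (f b) := by
  unfold LatticeTerms.inf
  rw [← FirstOrder.Language.HomClass.realize_term]
  congr 1
  funext i
  fin_cases i <;> rfl

theorem map_sup {L : FirstOrder.Language.{u, v}} (τ : LatticeTerms L) {A B : Type w} [L.Structure A]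
    [L.Structure B] (f : A →[L] B) (a b : A) : f (τ.sup A a b) = τ.sup B (f a) (f b) := by
  unfold LatticeTerms.sup
  rw [← FirstOrder.Language.HomClass.realize_term]
  congr 1
  funext i
  fin_cases i <;> rfl

theorem map_bot {L : FirstOrder.Language.{u, v}} (τ : LatticeTerms L) {A B : Type w} [L.Structure A]
    [L.Structure B] (f : A →[L] B) : f (τ.bot A) = τ.bot B := by
  unfold LatticeTerms.bot
  rw [← FirstOrder.Language.HomClass.realize_term]
  congr 1
  funext i
  exact i.elim

theorem map_top {L : FirstOrder.Language.{u, v}} (τ : LatticeTerms L) {A B : Type w} [L.Structure A]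
    [L.Structure B] (f : A →[L] B) : f (τ.top A) = τ.top B := by
  unfold LatticeTerms.top
  rw [← FirstOrder.Language.HomClass.realize_term]
  congr 1
  funext i
  exact i.elim

/-- The forgetful functor `U : 𝒜 ⥤ D`, sending an algebra to its reduct and a homomorphism to
itself. Here `𝒜` is regarded as a full subcategory of the category of `L`-algebras. -/
def forgetD {L : FirstOrder.Language.{u, v}} (τ : LatticeTerms L) (𝒜 : ObjectProperty (Alg.{u, v, w} L))
    (h𝒜 : IsDBased τ 𝒜) : 𝒜.FullSubcategory ⥤ BddDistLat.{w} where
  obj A := (h𝒜 A.obj A.property).reduct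
  map {A B} f :=
    letI := (h𝒜 A.obj A.property).distribLattice
    letI := (h𝒜 A.obj A.property).boundedOrder
    letI := (h𝒜 B.obj B.property).distribLattice
    letI := (h𝒜 B.obj B.property).boundedOrder
    BddDistLat.ofHom
      { toFun := fun a => (show A.obj →[L] B.obj from f.hom) a
        map_sup' := map_sup τ (show A.obj →[L] B.obj from f.hom)
        map_inf' := map_inf τ (show A.obj →[L] B.obj from f.hom)
        map_top' := map_top τ (show A.obj →[L] B.obj from f.hom)
        map_bot' := map_bot τ (show A.obj →[L] B.obj from f.hom) }
  map_id _ := rfl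
  map_comp _ _ := rfl

/-- A functor preserves (small) coproducts: it sends universal co-cones over families of objects
to universal co-cones, for families indexed by an arbitrary (possibly empty) set. -/
def PreservesCoproducts {C D : Type*} [Category* C] [Category* D] (F : C ⥤ D) : Prop :=
  ∀ ι : Type w, Limits.PreservesColimitsOfShape (Discrete ι) F

/-- The algebra `B` is subdirectly irreducible relative to `𝒜`: it belongs to `𝒜`, and whenever it
is isomorphic to a subdirect product of algebras in `𝒜` (that is, embeds into a product of members
of `𝒜` with all coordinate maps surjective), it is isomorphic to at least one of the components. -/
def IsRelSI {L : FirstOrder.Language.{u, v}} (𝒜 : ObjectProperty (Alg.{u, v, w} L)) (B : Alg.{u, v, w} L) :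
    Prop :=
  𝒜 B ∧ ∀ (ι : Type w) (C : ι → Alg.{u, v, w} L), (∀ i, 𝒜 (C i)) →
    ∀ f : B ↪[L] (∀ i, C i), (∀ i, Function.Surjective fun b => f b i) →
      ∃ i, Nonempty (B ≃[L] C i)

/-- The separation condition for `M` and a map `ω : M → {0, 1}`: the maps `ω ∘ u`, with `u` an
endomorphism of `M`, separate the elements of `M`. -/
def Sep {L : FirstOrder.Language.{u, v}} (M : Alg.{u, v, w} L) (ω : M → Bool) : Prop :=
  ∀ a b : M, (∀ u : M →[L] M, ω (u a) = ω (u b)) → a = b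

/-- A set of subalgebras of `A`, ordered by inclusion, has a top element. -/
def HasTop {L : FirstOrder.Language.{u, v}} {A : Type w} [L.Structure A] (S : Set (L.Substructure A)) : Prop :=
  ∃ T, IsGreatest S T

end CoprodPres

/-!
# Preservation of coproducts by the forgetful functor to bounded distributive lattices

A co-cone of bounded distributive lattices is universal exactly if the images of its legs generate
its vertex and every family of homomorphisms from the components to `2` extends to the vertex
(`existsUnique_boundedLatticeHom_extending` for the direction that needs the prime ideal theorem).
The theorem comes from reading both conditions in `𝒜`.

*Extension.* Suppose that `𝒜 = ISP(M)` with `M` finite, and that the maps `ω ∘ u` separate the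
points of `M`. Then the maps `ω ∘ x`, for homomorphisms `x : A → M`, separate the points of each `A`
in `𝒜`. A point-separating set of homomorphisms to `2` is dense in the space of all of them
(`exists_mem_forall_eq_of_separating`), and this one is compact, so every homomorphism from the
reduct of `A` to `2` is of the form `ω ∘ x` (`exists_hom_of_boolHom`). Families of homomorphisms to
`2` therefore extend to coproducts by the universal property in `𝒜`. Conversely, if coproducts are
preserved, then a coproduct of enough copies of the generating algebras carries an `ω` which
extends all homomorphisms from the generators to `2`, and hence separates points
(`exists_sep_of_preservesCoproducts`).

*Generation.* If coproducts are preserved, the image in `A` of the coproduct of all subalgebras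
contained in a sublattice `K` stays inside `K`, and so it is the top one
(`hasTop_of_preservesCoproducts`). For `A = M²` and `K = {(c₁, c₂) | ω c₁ ≤ ω c₂}` this gives the
compatible subalgebra `R` of `M²`. Conversely, a bounded sublattice is determined by the
inequalities between homomorphisms to `2` that hold on it (`exists_boolHom_of_notMem`). Let `ω ∘ y`
and `ω ∘ z` satisfy such an inequality on the sublattice generated by the images of the components
of a coproduct. Then `(y, z)` maps each component into `R`, so it maps the whole coproduct into `R`,
and the inequality holds everywhere (`le_of_hasTop`). Hence the images generate the reduct.

*Relative subdirect irreducibility.* A pair `(M, ω)` as above with `M` of least cardinality is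
relatively subdirectly irreducible, since `ω` factors through a component of any subdirect
decomposition (`exists_isRelSI_sep`). In the other direction, finite members of `𝒜` decompose into
relatively subdirectly irreducible ones, by induction on the cardinality
(`ISP_of_finite_of_isRelSI`).
-/

namespace CoprodPres

/-! ### Homomorphisms from a bounded distributive lattice to `2` -/

section Lattice

variable {D : Type*} [DistribLattice D] [BoundedOrder D]

/-- The prime separation theorem, for a down-directed set `F` and an up-directed set `I`, in terms
of homomorphisms to `2`. -/
theorem exists_boolHom_of_forall_not_le {F I : Set D} (hF : F.Nonempty) (hI : I.Nonempty)
    (hFinf : InfClosed F) (hIsup : SupClosed I) (h : ∀ a ∈ F, ∀ b ∈ I, ¬ a ≤ b) :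
    ∃ φ : BoundedLatticeHom D Bool, (∀ a ∈ F, φ a = true) ∧ ∀ b ∈ I, φ b = false := by
  have hF' : Order.IsPFilter {x | ∃ a ∈ F, a ≤ x} := by
    refine Order.IsPFilter.of_def ?_ ?_ ?_
    · obtain ⟨a, ha⟩ := hF
      exact ⟨a, a, ha, le_rfl⟩
    · rintro x ⟨a, ha, hax⟩ y ⟨b, hb, hby⟩
      exact ⟨a ⊓ b, ⟨a ⊓ b, hFinf ha hb, le_rfl⟩, inf_le_left.trans hax, inf_le_right.trans hby⟩
    · rintro x y hxy ⟨a, ha, hax⟩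
      exact ⟨a, ha, hax.trans hxy⟩
  have hI' : Order.IsIdeal {x | ∃ b ∈ I, x ≤ b} := by
    refine ⟨?_, ?_, ?_⟩
    · rintro x y hyx ⟨b, hb, hxb⟩
      exact ⟨b, hb, hyx.trans hxb⟩
    · obtain ⟨b, hb⟩ := hI
      exact ⟨b, b, hb, le_rfl⟩
    · rintro x ⟨a, ha, hxa⟩ y ⟨b, hb, hyb⟩
      exact ⟨a ⊔ b, ⟨a ⊔ b, hIsup ha hb, le_rfl⟩, hxa.trans le_sup_left, hyb.trans le_sup_right⟩
  have hdisj : Disjoint (hF'.toPFilter : Set D) (hI'.toIdeal : Set D) := by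
    refine Set.disjoint_left.2 ?_
    rintro x ⟨a, ha, hax⟩ ⟨b, hb, hxb⟩
    exact h a ha b hb (hax.trans hxb)
  obtain ⟨J, hJ, hIJ, hFJ⟩ := DistribLattice.prime_ideal_of_disjoint_filter_ideal hdisj
  classical
  refine ⟨{ toFun := fun a => decide (a ∉ J), map_sup' := ?_, map_inf' := ?_, map_top' := ?_,
            map_bot' := ?_ }, ?_, ?_⟩
  · intro a b
    by_cases ha : a ∈ J <;> by_cases hb : b ∈ J <;> simp [ha, hb, Order.Ideal.sup_mem_iff]
  · intro a b
    have : a ⊓ b ∈ J ↔ a ∈ J ∨ b ∈ J :=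
      ⟨hJ.mem_or_mem, fun h => h.elim (J.lower inf_le_left) (J.lower inf_le_right)⟩
    by_cases ha : a ∈ J <;> by_cases hb : b ∈ J <;> simp [ha, hb, this]
  · simpa using hJ.toIsProper.top_notMem
  · simp
  · intro a ha
    have : a ∉ J := Set.disjoint_left.1 hFJ (show a ∈ hF'.toPFilter from ⟨a, ha, le_rfl⟩)
    simpa using this
  · intro b hb
    have : b ∈ J := hIJ (show b ∈ hI'.toIdeal from ⟨b, hb, le_rfl⟩)
    simpa using this

theorem exists_boolHom_of_not_le {a b : D} (h : ¬ a ≤ b) :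
    ∃ φ : BoundedLatticeHom D Bool, φ a = true ∧ φ b = false := by
  obtain ⟨φ, ha, hb⟩ := exists_boolHom_of_forall_not_le (Set.singleton_nonempty a)
    (Set.singleton_nonempty b) infClosed_singleton supClosed_singleton (by simpa using h)
  exact ⟨φ, ha a rfl, hb b rfl⟩

theorem exists_boolHom_ne {a b : D} (h : a ≠ b) : ∃ φ : BoundedLatticeHom D Bool, φ a ≠ φ b := by
  by_cases hab : a ≤ b
  · obtain ⟨φ, h₁, h₂⟩ := exists_boolHom_of_not_le fun hba => h (le_antisymm hab hba)
    exact ⟨φ, by simp [h₁, h₂]⟩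
  · obtain ⟨φ, h₁, h₂⟩ := exists_boolHom_of_not_le hab
    exact ⟨φ, by simp [h₁, h₂]⟩

/-- A bounded sublattice `K` is determined by the order that the homomorphisms to `2` have on `K`:
an element outside `K` breaks an inequality which holds on all of `K`. -/
theorem exists_boolHom_of_notMem {K : Sublattice D} (hbot : ⊥ ∈ K) (htop : ⊤ ∈ K) {c : D}
    (hc : c ∉ K) : ∃ φ ψ : BoundedLatticeHom D Bool,
      (∀ k ∈ K, φ k ≤ ψ k) ∧ φ c = true ∧ ψ c = false := by
  let _ : BoundedOrder K := Subtype.boundedOrder hbot htop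
  -- A prime filter `χ` of `K` containing all elements above `c` and none below `c`.
  obtain ⟨χ, hχ₁, hχ₂⟩ := exists_boolHom_of_forall_not_le (D := K)
    (F := {k | c ≤ (k : D)}) (I := {k | (k : D) ≤ c})
    ⟨⊤, show c ≤ ⊤ from le_top⟩ ⟨⊥, show ⊥ ≤ c from bot_le⟩
    (fun a ha b hb => le_inf (show c ≤ (a : D) from ha) hb)
    (fun a ha b hb => sup_le (show (a : D) ≤ c from ha) hb)
    (fun a ha b hb hab => hc (by
      have : c = a := le_antisymm ha (le_trans (show (a : D) ≤ b from hab) hb)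
      exact this ▸ a.2))
  have hmono : Monotone χ := OrderHomClass.mono χ
  obtain ⟨φ, hφ₁, hφ₂⟩ := exists_boolHom_of_forall_not_le (D := D)
    (F := {c}) (I := {d | ∃ k : K, (k : D) = d ∧ χ k = false})
    (Set.singleton_nonempty c) ⟨⊥, ⊥, rfl, BotHomClass.map_bot χ⟩ infClosed_singleton
    (by
      rintro _ ⟨a, rfl, ha⟩ _ ⟨b, rfl, hb⟩
      exact ⟨a ⊔ b, rfl, by simp [ha, hb]⟩)
    (by
      rintro _ rfl _ ⟨k, rfl, hk⟩ hck
      simp [hχ₁ k hck] at hk)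
  obtain ⟨ψ, hψ₁, hψ₂⟩ := exists_boolHom_of_forall_not_le (D := D)
    (F := {d | ∃ k : K, (k : D) = d ∧ χ k = true}) (I := {c})
    ⟨⊤, ⊤, rfl, TopHomClass.map_top χ⟩ (Set.singleton_nonempty c)
    (by
      rintro _ ⟨a, rfl, ha⟩ _ ⟨b, rfl, hb⟩
      exact ⟨a ⊓ b, rfl, by simp [ha, hb]⟩)
    supClosed_singleton
    (by
      rintro _ ⟨k, rfl, hk⟩ _ rfl hck
      simp [hχ₂ k hck] at hk)
  refine ⟨φ, ψ, fun k hk => ?_, hφ₁ c rfl, hψ₂ c rfl⟩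
  cases hk' : χ ⟨k, hk⟩
  · rw [hφ₂ k ⟨⟨k, hk⟩, rfl, hk'⟩]
    exact Bool.false_le _
  · rw [hψ₁ k ⟨⟨k, hk⟩, rfl, hk'⟩]
    exact Bool.le_true _

/-- A set of homomorphisms to `2` which separates points is dense in the space of all of them. -/
theorem exists_mem_forall_eq_of_separating {Y : Set (BoundedLatticeHom D Bool)}
    (hY : ∀ a b : D, (∀ y ∈ Y, y a = y b) → a = b) (φ : BoundedLatticeHom D Bool) (F : Finset D) :
    ∃ y ∈ Y, ∀ f ∈ F, y f = φ f := by
  let a := (F.filter fun f => φ f = true).inf id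
  let b := (F.filter fun f => φ f = false).sup id
  have ha : φ a = true := by
    have : φ a = ⊤ := by
      rw [map_finset_inf]
      exact (Finset.inf_eq_top_iff _ _).2 fun f hf => (Finset.mem_filter.1 hf).2
    exact this
  have hb : φ b = false := by
    have : φ b = ⊥ := by
      rw [map_finset_sup]
      exact (Finset.sup_eq_bot_iff _ _).2 fun f hf => (Finset.mem_filter.1 hf).2
    exact this
  -- As `φ` separates `a` from `a ⊓ b`, some `y ∈ Y` does so too, and then `y` agrees with `φ`.
  have hne : a ⊓ b ≠ a := fun h => by
    have := congrArg φ h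
    simp [ha, hb] at this
  obtain ⟨y, hy, hyab⟩ : ∃ y ∈ Y, y (a ⊓ b) ≠ y a := by
    by_contra! h
    exact hne (hY _ _ h)
  have hya : y a = true := by
    by_contra h
    simp [h] at hyab
  have hyb : y b = false := by
    by_contra h
    simp [h] at hyab
  have hmono : Monotone y := OrderHomClass.mono y
  refine ⟨y, hy, fun f hf => ?_⟩
  cases hφ : φ f
  · have : f ≤ b := Finset.le_sup (f := id) (Finset.mem_filter.2 ⟨hf, hφ⟩)
    have := hmono this
    rw [hyb] at this
    exact Bool.eq_false_of_le_false this
  · have : a ≤ f := Finset.inf_le (f := id) (Finset.mem_filter.2 ⟨hf, hφ⟩)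
    have := hmono this
    rw [hya] at this
    exact Bool.eq_true_of_true_le this

/-- A cocone of bounded distributive lattices is universal if the images of its legs generate it and
every family of homomorphisms to `2` extends along the legs. -/
theorem existsUnique_boundedLatticeHom_extending {ι : Type*} {B : ι → Type*}
    [∀ i, DistribLattice (B i)] [∀ i, BoundedOrder (B i)] {E : Type*} [DistribLattice E]
    [BoundedOrder E] (e : ∀ i, BoundedLatticeHom (B i) D)
    (hgen : ∀ S : Sublattice D, ⊥ ∈ S → ⊤ ∈ S → (∀ i b, e i b ∈ S) → ∀ x, x ∈ S)
    (hext : ∀ φ : ∀ i, BoundedLatticeHom (B i) Bool,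
      ∃ ψ : BoundedLatticeHom D Bool, ∀ i b, ψ (e i b) = φ i b)
    (g : ∀ i, BoundedLatticeHom (B i) E) :
    ∃! h : BoundedLatticeHom D E, ∀ i b, h (e i b) = g i b := by
  choose ψ hψ using fun κ : BoundedLatticeHom E Bool => hext fun i => κ.comp (g i)
  have hsep : ∀ a b : E, (∀ κ : BoundedLatticeHom E Bool, κ a = κ b) → a = b := fun a b h => by
    by_contra hab
    obtain ⟨κ, hκ⟩ := exists_boolHom_ne hab
    exact hκ (h κ)
  -- The extensions `ψ κ` are the coordinates, in the embedding of `E` into a power of `2`, of the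
  -- map to be found; the elements at which it is defined form a bounded sublattice.
  have hdef : ∀ x : D, ∃ y : E, ∀ κ : BoundedLatticeHom E Bool, κ y = ψ κ x := by
    let S : Sublattice D :=
      { carrier := {x | ∃ y : E, ∀ κ : BoundedLatticeHom E Bool, κ y = ψ κ x}
        supClosed' := by
          rintro a ⟨y, hy⟩ b ⟨z, hz⟩
          exact ⟨y ⊔ z, fun κ => by simp [hy, hz]⟩
        infClosed' := by
          rintro a ⟨y, hy⟩ b ⟨z, hz⟩
          exact ⟨y ⊓ z, fun κ => by simp [hy, hz]⟩ }
    exact hgen S ⟨⊥, fun κ => by simp⟩ ⟨⊤, fun κ => by simp⟩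
      fun i b => ⟨g i b, fun κ => by simp [hψ]⟩
  choose h hh using hdef
  refine ⟨{ toFun := h, map_sup' := ?_, map_inf' := ?_, map_top' := ?_, map_bot' := ?_ }, ?_, ?_⟩
  · exact fun a b => hsep _ _ fun κ => by simp [hh]
  · exact fun a b => hsep _ _ fun κ => by simp [hh]
  · exact hsep _ _ fun κ => by simp [hh]
  · exact hsep _ _ fun κ => by simp [hh]
  · exact fun i b => hsep _ _ fun κ => by
      change κ (h (e i b)) = _
      simp [hh, hψ]
  · intro k hk
    let S : Sublattice D :=
      { carrier := {x | k x = h x}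
        supClosed' := fun a ha b hb => hsep _ _ fun κ => by
          simp only [Set.mem_ofPred_eq] at ha hb
          simp [ha, hb, hh]
        infClosed' := fun a ha b hb => hsep _ _ fun κ => by
          simp only [Set.mem_ofPred_eq] at ha hb
          simp [ha, hb, hh] }
    refine DFunLike.ext _ _ fun x => hgen S ?_ ?_ ?_ x
    · exact hsep _ _ fun κ => by simp [hh]
    · exact hsep _ _ fun κ => by simp [hh]
    · exact fun i b => hsep _ _ fun κ => by rw [hk i b, hh, hψ]; rfl

end Lattice

/-! ### Quasivarieties of algebras -/

section Algebra

open FirstOrder.Language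

variable {L : FirstOrder.Language.{u, v}}

/-- The coordinate projection from a product of algebras. -/
def piEval {ι : Type*} {B : ι → Type*} [∀ i, L.Structure (B i)] (i : ι) : (∀ i, B i) →[L] B i where
  toFun x := x i
  map_fun' _ _ := rfl
  map_rel' _ _ h := h i

/-- The homomorphism into a product of algebras with given coordinates. -/
def piLift {ι : Type*} {A : Type*} [L.Structure A] {B : ι → Type*} [∀ i, L.Structure (B i)]
    (f : ∀ i, A →[L] B i) : A →[L] (∀ i, B i) where
  toFun a i := f i a
  map_fun' g x := funext fun i => (f i).map_fun g x
  map_rel' r x h i := (f i).map_rel r x h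

/-- The first projection from a binary product of algebras. -/
def fstHom {A B : Type*} [L.Structure A] [L.Structure B] : A × B →[L] A where
  toFun := Prod.fst
  map_fun' _ _ := rfl
  map_rel' _ _ h := h.1

/-- The second projection from a binary product of algebras. -/
def sndHom {A B : Type*} [L.Structure A] [L.Structure B] : A × B →[L] B where
  toFun := Prod.snd
  map_fun' _ _ := rfl
  map_rel' _ _ h := h.2

/-- The homomorphism into a binary product of algebras with given coordinates. -/
def pairHom {A B C : Type*} [L.Structure A] [L.Structure B] [L.Structure C] (f : C →[L] A)
    (g : C →[L] B) : C →[L] A × B where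
  toFun c := (f c, g c)
  map_fun' h x := Prod.ext (f.map_fun h x) (g.map_fun h x)
  map_rel' r x h := ⟨f.map_rel r x h, g.map_rel r x h⟩

variable [L.IsAlgebraic]

/-- A bijective homomorphism of algebras is an isomorphism. -/
theorem nonempty_equiv_of_bijective {A B : Type*} [L.Structure A] [L.Structure B] (f : A →[L] B)
    (hf : Function.Bijective f) : Nonempty (A ≃[L] B) :=
  ⟨{ _root_.Equiv.ofBijective f hf with
      map_fun' := fun g x => f.map_fun g x
      map_rel' := fun r => isEmptyElim r }⟩

/-- An algebra is in `ISP(𝓜)` exactly if its homomorphisms to members of `𝓜` separate points. -/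
theorem ISP_iff {𝓜 : Set (Alg.{u, v, w} L)} {A : Alg.{u, v, w} L} :
    ISP 𝓜 A ↔ ∀ a b : A, (∀ M ∈ 𝓜, ∀ x : A →[L] M, x a = x b) → a = b := by
  constructor
  · rintro ⟨_, ⟨_, ⟨ι, B, hB, rfl⟩, C, rfl⟩, ⟨e⟩⟩ a b h
    refine e.injective (Subtype.ext (funext fun i => ?_))
    exact h (B i) (hB i) ((piEval i).comp (C.subtype.toHom.comp e.toHom))
  · intro h
    have h' : ∀ p : {p : A × A // p.1 ≠ p.2}, ∃ M ∈ 𝓜, ∃ x : A →[L] M, x p.1.1 ≠ x p.1.2 := by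
      intro p
      by_contra! hp
      exact p.2 (h _ _ hp)
    choose M hM x hx using h'
    have hinj : Function.Injective (piLift x) := fun a b hab => by
      by_contra hne
      exact hx ⟨(a, b), hne⟩ (congrFun hab ⟨(a, b), hne⟩)
    let f : A ↪[L] (∀ p, M p) := Embedding.ofInjective hinj
    exact ⟨_, ⟨_, ⟨_, M, hM, rfl⟩, f.toHom.range, rfl⟩, ⟨f.equivRange⟩⟩

variable {𝒜 : ObjectProperty (Alg.{u, v, w} L)}

/-- A quasivariety contains each algebra whose homomorphisms to its members separate points. -/
theorem mem_of_separating {𝓜 : Set (Alg.{u, v, w} L)} (h𝒜 : 𝒜 = ISP 𝓜) {A : Alg.{u, v, w} L}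
    (h : ∀ a b : A, (∀ B : Alg.{u, v, w} L, 𝒜 B → ∀ x : A →[L] B, x a = x b) → a = b) : 𝒜 A := by
  subst h𝒜
  refine ISP_iff.2 fun a b hab => h a b fun B hB x => ISP_iff.1 hB _ _ fun M hM y => ?_
  exact hab M hM (y.comp x)

theorem mem_of_mem_generators {𝓜 : Set (Alg.{u, v, w} L)} (h𝒜 : 𝒜 = ISP 𝓜)
    {M : Alg.{u, v, w} L} (hM : M ∈ 𝓜) : 𝒜 M := by
  subst h𝒜
  exact ISP_iff.2 fun a b h => h M hM (Hom.id L M)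

/-- A member of a quasivariety to which the homomorphisms separate points generates it. -/
theorem eq_ISP_singleton {𝓜 : Set (Alg.{u, v, w} L)} (h𝒜 : 𝒜 = ISP 𝓜) {M : Alg.{u, v, w} L}
    (hM : 𝒜 M)
    (h : ∀ A : Alg.{u, v, w} L, 𝒜 A → ∀ a b : A, (∀ x : A →[L] M, x a = x b) → a = b) :
    𝒜 = ISP {M} := by
  funext A
  refine propext ⟨fun hA => ISP_iff.2 fun a b hab => h A hA a b (hab M rfl), fun hA => ?_⟩
  refine mem_of_separating h𝒜 fun a b hab => ISP_iff.1 hA a b ?_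
  rintro _ rfl x
  exact hab _ hM x

theorem mem_of_injective {𝓜 : Set (Alg.{u, v, w} L)} (h𝒜 : 𝒜 = ISP 𝓜) {A B : Alg.{u, v, w} L}
    (hB : 𝒜 B) (f : A →[L] B) (hf : Function.Injective f) : 𝒜 A :=
  mem_of_separating h𝒜 fun _ _ h => hf (h B hB f)

theorem mem_substructure {𝓜 : Set (Alg.{u, v, w} L)} (h𝒜 : 𝒜 = ISP 𝓜) {A : Alg.{u, v, w} L}
    (hA : 𝒜 A) (S : L.Substructure A) : 𝒜 ⟨S⟩ :=
  mem_of_injective h𝒜 hA S.subtype.toHom S.subtype.injective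

theorem mem_prod {𝓜 : Set (Alg.{u, v, w} L)} (h𝒜 : 𝒜 = ISP 𝓜) {A B : Alg.{u, v, w} L}
    (hA : 𝒜 A) (hB : 𝒜 B) : 𝒜 ⟨A × B⟩ :=
  mem_of_separating h𝒜 fun _ _ h => Prod.ext (h A hA fstHom) (h B hB sndHom)

/-- A relatively subdirectly irreducible member of `ISP(𝓜)` embeds into a member of `𝓜`. -/
theorem IsRelSI.exists_injective {𝓜 : Set (Alg.{u, v, w} L)} (h𝒜 : 𝒜 = ISP 𝓜)
    {B : Alg.{u, v, w} L} (hB : IsRelSI 𝒜 B) :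
    ∃ M ∈ 𝓜, ∃ x : B →[L] M, Function.Injective x := by
  have hsep := ISP_iff.1 (h𝒜.le _ hB.1)
  have h' : ∀ p : {p : B × B // p.1 ≠ p.2}, ∃ M ∈ 𝓜, ∃ x : B →[L] M, x p.1.1 ≠ x p.1.2 := by
    intro p
    by_contra! hp
    exact p.2 (hsep _ _ hp)
  choose M hM x hx using h'
  -- `B` is a subdirect product of the images of the separating homomorphisms `x p`.
  let y : ∀ p, B →[L] (x p).range := fun p => (x p).codRestrict _ fun b => (x p).mem_range_self b
  have hinj : Function.Injective (piLift y) := fun a b hab => by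
    by_contra hne
    exact hx ⟨(a, b), hne⟩ (congrArg Subtype.val (congrFun hab ⟨(a, b), hne⟩))
  obtain ⟨p, ⟨e⟩⟩ := hB.2 _ (fun p => ⟨(x p).range⟩)
    (fun p => mem_substructure h𝒜 (mem_of_mem_generators h𝒜 (hM p)) _)
    (Embedding.ofInjective hinj) (by
      rintro p ⟨_, b, rfl⟩
      exact ⟨b, rfl⟩)
  exact ⟨M p, hM p, (x p).range.subtype.toHom.comp e.toHom,
    (x p).range.subtype.injective.comp e.injective⟩

/-- A class which contains all relatively subdirectly irreducible algebras generates all finite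
members of the quasivariety. -/
theorem ISP_of_finite_of_isRelSI {𝒩 : Set (Alg.{u, v, w} L)}
    (h : ∀ B : Alg.{u, v, w} L, IsRelSI 𝒜 B → ISP 𝒩 B) (A : Alg.{u, v, w} L) (hA : 𝒜 A)
    [Finite A] : ISP 𝒩 A := by
  induction hn : Nat.card A using Nat.strong_induction_on generalizing A with
  | _ n ih =>
    by_cases hSI : IsRelSI 𝒜 A
    · exact h A hSI
    -- Otherwise `A` is a subdirect product of algebras with fewer elements.
    simp only [IsRelSI, hA, true_and, not_forall, not_exists] at hSI
    obtain ⟨ι, C, hC, f, hf, hne⟩ := hSI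
    refine ISP_iff.2 fun a b hab => f.injective (funext fun i => ?_)
    have : Finite (C i) := Finite.of_surjective _ (hf i)
    let g : A →[L] C i := (piEval i).comp f.toHom
    have hlt : Nat.card (C i) < n := by
      refine lt_of_le_of_ne (hn ▸ Nat.card_le_card_of_surjective _ (hf i)) fun heq => ?_
      have hbij : Function.Bijective g :=
        (Nat.bijective_iff_surjective_and_card g).2 ⟨hf i, by rw [heq, hn]⟩
      exact hne i (nonempty_equiv_of_bijective g hbij)
    refine ISP_iff.1 (ih _ hlt (C i) (hC i) rfl) _ _ fun M hM x => ?_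
    exact hab M hM (x.comp g)

end Algebra

/-! ### Homomorphisms from a reduct to `2` -/

section Reduct

open FirstOrder.Language

variable {L : FirstOrder.Language.{u, v}} {τ : LatticeTerms L}
  {𝒜 : ObjectProperty (Alg.{u, v, w} L)} (hD : IsDBased τ 𝒜)

/-- A homomorphism of algebras, as a homomorphism between the reducts. -/
def redHom {A B : 𝒜.FullSubcategory} (f : A.obj →[L] B.obj) :
    BoundedLatticeHom ((forgetD τ 𝒜 hD).obj A) ((forgetD τ 𝒜 hD).obj B) :=
  ((forgetD τ 𝒜 hD).map (X := A) (Y := B) ⟨f⟩).hom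

variable {hD}

/-- The separation condition on `(M, ω)` passes from `M` to all algebras of `ISP(M)`. -/
theorem Sep.eq_of_forall [L.IsAlgebraic] {M A : Alg.{u, v, w} L} {ω : M → Bool} (hω : Sep M ω)
    (hA : ISP {M} A) {a b : A} (h : ∀ x : A →[L] M, ω (x a) = ω (x b)) : a = b := by
  refine ISP_iff.1 hA a b ?_
  rintro _ rfl x
  exact hω _ _ fun u => h (u.comp x)

/-- If the maps `ω ∘ x`, with `x : A → M` a homomorphism to a finite algebra, separate the points
of `A`, then every homomorphism from the reduct of `A` to `2` is of this form: these maps are dense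
in the space of all homomorphisms to `2`, and they form a compact set. -/
theorem exists_hom_of_boolHom [L.IsAlgebraic] {M : 𝒜.FullSubcategory} [Finite M.obj]
    (ω : BoundedLatticeHom ((forgetD τ 𝒜 hD).obj M) Bool) {A : 𝒜.FullSubcategory}
    (hsep : ∀ a b : A.obj, (∀ x : A.obj →[L] M.obj, ω (x a) = ω (x b)) → a = b)
    (φ : BoundedLatticeHom ((forgetD τ 𝒜 hD).obj A) Bool) :
    ∃ x : A.obj →[L] M.obj, ∀ a : A.obj, ω (x a) = φ a := by
  let _ : TopologicalSpace M.obj := ⊥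
  have : DiscreteTopology M.obj := ⟨rfl⟩
  let H : Set (A.obj → M.obj) := {x | ∀ (n : ℕ) (f : L.Functions n) (v : Fin n → A.obj),
    x (Structure.funMap f v) = Structure.funMap f fun j => x (v j)}
  have hH : IsClosed H := by
    simp only [H, Set.ofPred_forall]
    refine isClosed_iInter fun n => isClosed_iInter fun f => isClosed_iInter fun v => ?_
    refine isClosed_eq (continuous_apply _) ?_
    exact (continuous_of_discreteTopology (f := fun y : Fin n → M.obj => Structure.funMap f y)).comp
      (continuous_pi fun j => continuous_apply (v j))
  let T : A.obj → Set (A.obj → M.obj) := fun a => {x | ω (x a) = φ a}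
  have hT : ∀ a, IsClosed (T a) := fun a =>
    (isClosed_discrete {m : M.obj | ω m = φ a}).preimage (f := fun x : A.obj → M.obj => x a)
      (continuous_apply a)
  obtain ⟨x, hxH, hxT⟩ := hH.isCompact.inter_iInter_nonempty T hT fun F => by
    obtain ⟨_, ⟨x, rfl⟩, hx⟩ := exists_mem_forall_eq_of_separating
      (Y := Set.range fun x : A.obj →[L] M.obj => ω.comp (redHom hD x))
      (fun a b h => hsep a b fun x => h _ ⟨x, rfl⟩) φ F
    refine ⟨x, fun n f v => x.map_fun f v, ?_⟩
    simp only [Set.mem_iInter]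
    exact fun a ha => hx a ha
  refine ⟨⟨x, fun f v => hxH _ f v, fun r => isEmptyElim r⟩, fun a => ?_⟩
  exact Set.mem_iInter.1 hxT a

/-- If the subalgebras of `M²` inside `{(c₁, c₂) | ω c₁ ≤ ω c₂}` have a top element, then an
inequality between `ω ∘ x` and `ω ∘ y` spreads from the images of a family of homomorphisms to the
subalgebra that these generate, which lies in the preimage of the top element under `(x, y)`. -/
theorem le_of_hasTop {M C : Alg.{u, v, w} L} {ω : M → Bool}
    (htop : HasTop {R : L.Substructure (M × M) | ∀ c : M × M, c ∈ R → ω c.1 ≤ ω c.2})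
    {ι : Type*} {A : ι → Alg.{u, v, w} L} (e : ∀ i, A i →[L] C)
    (hgen : ∀ S : L.Substructure C, (∀ i a, e i a ∈ S) → ∀ c, c ∈ S) (x y : C →[L] M)
    (h : ∀ i a, ω (x (e i a)) ≤ ω (y (e i a))) (c : C) : ω (x c) ≤ ω (y c) := by
  obtain ⟨R, hR, hmax⟩ := htop
  refine hR (x c, y c) (hgen (R.comap (pairHom x y)) (fun i a => ?_) c)
  have : ((pairHom x y).comp (e i)).range ≤ R := hmax (by
    rintro _ ⟨a, rfl⟩
    exact h i a)
  exact this ⟨a, rfl⟩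

end Reduct

/-! ### Coproducts in a quasivariety -/

section Coproduct

open FirstOrder.Language Limits

variable {L : FirstOrder.Language.{u, v}} {τ : LatticeTerms L}
  {𝒜 : ObjectProperty (Alg.{u, v, w} L)}

/-- The legs of a co-cone in `𝒜`, as homomorphisms of algebras. -/
def leg {ι : Type w} {A : ι → 𝒜.FullSubcategory} (c : Cofan A) (i : ι) :
    (A i).obj →[L] c.pt.obj :=
  (c.inj i).hom

/-- The homomorphism out of a coproduct in `𝒜` given by homomorphisms on the components. -/
theorem exists_hom_leg {ι : Type w} {A : ι → 𝒜.FullSubcategory} {c : Cofan A} (hc : IsColimit c)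
    {B : 𝒜.FullSubcategory} (f : ∀ i, (A i).obj →[L] B.obj) :
    ∃ h : c.pt.obj →[L] B.obj, ∀ i a, h (leg c i a) = f i a := by
  refine ⟨(Cofan.IsColimit.desc hc (A := B) fun i => ⟨f i⟩).hom, fun i a => ?_⟩
  have := Cofan.IsColimit.fac hc (A := B) (fun i => ⟨f i⟩) i
  exact congrArg (fun g : A i ⟶ B => (show (A i).obj →[L] B.obj from g.hom) a) this

theorem hom_ext_leg {ι : Type w} {A : ι → 𝒜.FullSubcategory} {c : Cofan A} (hc : IsColimit c)
    {B : 𝒜.FullSubcategory} {f g : c.pt.obj →[L] B.obj}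
    (h : ∀ i a, f (leg c i a) = g (leg c i a)) : f = g := by
  have : (⟨f⟩ : c.pt ⟶ B) = ⟨g⟩ := Cofan.IsColimit.hom_ext hc _ _ fun i =>
    InducedCategory.hom_ext (FirstOrder.Language.Hom.ext fun a => h i a)
  exact congrArg InducedCategory.Hom.hom this

variable [L.IsAlgebraic]

/-- A coproduct in a quasivariety is generated by the images of its components. -/
theorem mem_of_forall_leg_mem {𝓜 : Set (Alg.{u, v, w} L)} (h𝒜 : 𝒜 = ISP 𝓜) {ι : Type w}
    {A : ι → 𝒜.FullSubcategory} {c : Cofan A} (hc : IsColimit c) (S : L.Substructure c.pt.obj)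
    (hS : ∀ i a, leg c i a ∈ S) (x : c.pt.obj) : x ∈ S := by
  obtain ⟨h, hh⟩ := exists_hom_leg hc (B := ⟨⟨S⟩, mem_substructure h𝒜 c.pt.property S⟩)
    fun i => (leg c i).codRestrict S (hS i)
  have : S.subtype.toHom.comp h = FirstOrder.Language.Hom.id L c.pt.obj :=
    hom_ext_leg hc (B := c.pt) fun i a => congrArg Subtype.val (hh i a)
  have hx : ((h x : S) : c.pt.obj) = x := DFunLike.congr_fun this x
  exact hx ▸ (h x).2

/-- A finitely generated quasivariety has coproducts, and a finite coproduct of finite algebras is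
finite. The coproduct of `(A i)` is the subalgebra generated by the images of the `A i` in the
product of the generating algebras `M j` over all families of homomorphisms `A i → M j`. -/
theorem exists_isColimit_cofan {𝓜 : Set (Alg.{u, v, w} L)} (h𝒜 : 𝒜 = ISP 𝓜) (hfin : 𝓜.Finite)
    (hM𝓜 : ∀ M ∈ 𝓜, Finite M) {ι : Type w} (A : ι → 𝒜.FullSubcategory) :
    ∃ c : Cofan A, Nonempty (IsColimit c) ∧
      (Finite ι → (∀ i, Finite (A i).obj) → Finite c.pt.obj) := by
  -- The generating algebras are enumerated by `Fin n` to keep the product in the universe `w`.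
  obtain ⟨n, M, rfl⟩ : ∃ (n : ℕ) (M : Fin n → Alg.{u, v, w} L), Set.range M = 𝓜 := by
    obtain ⟨n, M, hM⟩ := hfin.fin_embedding
    exact ⟨n, M, hM⟩
  let X : Type w := Σ j : Fin n, ∀ i, (A i).obj →[L] M j
  let P : Alg.{u, v, w} L := ⟨∀ p : X, M p.1⟩
  have hP : 𝒜 P := mem_of_separating h𝒜 fun a b h => funext fun p =>
    h (M p.1) (mem_of_mem_generators h𝒜 ⟨p.1, rfl⟩) (piEval (B := fun p : X => M p.1) p)
  let e : ∀ i, (A i).obj →[L] P := fun i => piLift fun p => p.2 i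
  let S : L.Substructure P := Substructure.closure L {z | ∃ i a, z = e i a}
  let C : 𝒜.FullSubcategory := ⟨⟨S⟩, mem_substructure h𝒜 hP S⟩
  let eC : ∀ i, (A i).obj →[L] C.obj :=
    fun i => (e i).codRestrict S fun a => Substructure.subset_closure ⟨i, a, rfl⟩
  have hdesc : ∀ (B : 𝒜.FullSubcategory) (f : ∀ i, (A i).obj →[L] B.obj),
      ∃ h : C.obj →[L] B.obj, ∀ i a, h (eC i a) = f i a := by
    intro B f
    have hsep : ∀ a b : B.obj, (∀ j, ∀ y : B.obj →[L] M j, y a = y b) → a = b := fun a b h =>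
      ISP_iff.1 (h𝒜.le _ B.property) a b (by
        rintro _ ⟨j, rfl⟩ y
        exact h j y)
    -- The elements of the product at which the wanted homomorphism is defined.
    let T : L.Substructure P :=
      { carrier := {z | ∃ b : B.obj, ∀ (j : Fin n) (y : B.obj →[L] M j),
          y b = (show ∀ p : X, M p.1 from z) ⟨j, fun i => y.comp (f i)⟩}
        fun_mem := fun g z hz => by
          choose b hb using hz
          refine ⟨Structure.funMap g b, fun j y => ?_⟩
          rw [y.map_fun]
          exact congrArg (Structure.funMap g) (funext fun k => hb k j y) }
    have hST : S ≤ T := Substructure.closure_le.2 (by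
      rintro _ ⟨i, a, rfl⟩
      exact ⟨f i a, fun j y => rfl⟩)
    choose h hh using fun z : S => hST z.2
    refine ⟨⟨h, fun {k} g z => hsep _ _ fun j y => ?_, fun r => isEmptyElim r⟩, fun i a => ?_⟩
    · rw [y.map_fun, hh]
      exact congrArg (Structure.funMap g) (funext fun k => (hh (z k) j y).symm)
    · exact hsep _ _ fun j y => hh (eC i a) j y
  choose d hd using hdesc
  refine ⟨Cofan.mk C fun i => ⟨eC i⟩, ⟨Cofan.IsColimit.mk _
    (fun t => ⟨d t.pt fun i => leg t i⟩) (fun t i => ?_) (fun t m hm => ?_)⟩, fun _ _ => ?_⟩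
  · exact InducedCategory.hom_ext (FirstOrder.Language.Hom.ext fun a => hd t.pt _ i a)
  · refine InducedCategory.hom_ext (FirstOrder.Language.Hom.ext ?_)
    let m' : C.obj →[L] t.pt.obj := m.hom
    let d' : C.obj →[L] t.pt.obj := d t.pt fun i => leg t i
    suffices ∀ (z : P) (hz : z ∈ S), m' ⟨z, hz⟩ = d' ⟨z, hz⟩ from fun z => this z.1 z.2
    have hle : S ≤ (m'.eqLocus d').map S.subtype.toHom := Substructure.closure_le.2 (by
      rintro _ ⟨i, a, rfl⟩
      refine ⟨eC i a, ?_, rfl⟩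
      have := congrArg (fun g : A i ⟶ t.pt => (show (A i).obj →[L] t.pt.obj from g.hom) a) (hm i)
      exact Eq.trans this (hd t.pt (fun i => leg t i) i a).symm)
    intro z hz
    obtain ⟨z', hz', rfl⟩ := hle hz
    exact hz'
  · have : ∀ j, Finite (M j) := fun j => hM𝓜 _ ⟨j, rfl⟩
    have : ∀ i j, Finite ((A i).obj →[L] M j) := fun i j => DFunLike.finite _
    have : Finite X := inferInstance
    have : Finite P := inferInstanceAs (Finite (∀ p : X, M p.1))
    exact inferInstanceAs (Finite S)

end Coproduct

section Preservation

open FirstOrder.Language Limits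

variable {L : FirstOrder.Language.{u, v}} {τ : LatticeTerms L}
  {𝒜 : ObjectProperty (Alg.{u, v, w} L)} {hD : IsDBased τ 𝒜}

/-! ### Co-cones whose image under the forgetful functor is universal -/

/-- A universal co-cone of reducts extends homomorphisms given on the components. -/
theorem exists_boundedLatticeHom_leg {ι : Type w} {A : ι → 𝒜.FullSubcategory} {c : Cofan A}
    (hc : IsColimit ((forgetD τ 𝒜 hD).mapCocone c)) {E : Type w} [DistribLattice E]
    [BoundedOrder E] (g : ∀ i, BoundedLatticeHom ((forgetD τ 𝒜 hD).obj (A i)) E) :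
    ∃ h : BoundedLatticeHom ((forgetD τ 𝒜 hD).obj c.pt) E, ∀ i (a : (A i).obj),
      h (leg c i a) = g i a := by
  let s : Cocone (Discrete.functor A ⋙ forgetD τ 𝒜 hD) :=
    ⟨BddDistLat.of E, Discrete.natTrans fun i =>
      BddDistLat.ofHom (X := (forgetD τ 𝒜 hD).obj (A i.as)) (g i.as)⟩
  exact ⟨(hc.desc s).hom, fun i a =>
    (ConcreteCategory.comp_apply _ _ _).symm.trans (ConcreteCategory.congr_hom (hc.fac s ⟨i⟩) a)⟩

theorem boundedLatticeHom_ext_leg {ι : Type w} {A : ι → 𝒜.FullSubcategory} {c : Cofan A}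
    (hc : IsColimit ((forgetD τ 𝒜 hD).mapCocone c)) {E : Type w} [DistribLattice E]
    [BoundedOrder E] {f g : BoundedLatticeHom ((forgetD τ 𝒜 hD).obj c.pt) E}
    (h : ∀ i (a : (A i).obj), f (leg c i a) = g (leg c i a)) : f = g := by
  let f' : (forgetD τ 𝒜 hD).obj c.pt ⟶ BddDistLat.of E :=
    BddDistLat.ofHom (X := (forgetD τ 𝒜 hD).obj c.pt) f
  let g' : (forgetD τ 𝒜 hD).obj c.pt ⟶ BddDistLat.of E :=
    BddDistLat.ofHom (X := (forgetD τ 𝒜 hD).obj c.pt) g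
  have : f' = g' := hc.hom_ext fun ⟨i⟩ => ConcreteCategory.hom_ext _ _ fun a => h i a
  exact congrArg BddDistLat.Hom.hom this

/-- Every family of homomorphisms to `2` extends to the coproduct. -/
theorem exists_boolHom_leg {ι : Type w} {A : ι → 𝒜.FullSubcategory} {c : Cofan A}
    (hc : IsColimit ((forgetD τ 𝒜 hD).mapCocone c))
    (φ : ∀ i, BoundedLatticeHom ((forgetD τ 𝒜 hD).obj (A i)) Bool) :
    ∃ ψ : BoundedLatticeHom ((forgetD τ 𝒜 hD).obj c.pt) Bool, ∀ i (a : (A i).obj),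
      ψ (leg c i a) = φ i a := by
  -- The one-element power of `2` serves as a copy of `2` in the universe `w`.
  let d : BoundedLatticeHom Bool (PUnit.{w + 1} → Bool) :=
    { toFun := fun b _ => b, map_sup' := fun _ _ => rfl, map_inf' := fun _ _ => rfl,
      map_top' := rfl, map_bot' := rfl }
  let p : BoundedLatticeHom (PUnit.{w + 1} → Bool) Bool :=
    { toFun := fun b => b PUnit.unit, map_sup' := fun _ _ => rfl, map_inf' := fun _ _ => rfl,
      map_top' := rfl, map_bot' := rfl }
  obtain ⟨h, hh⟩ := exists_boundedLatticeHom_leg hc fun i => d.comp (φ i)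
  exact ⟨p.comp h, fun i a => congrFun (hh i a) PUnit.unit⟩

/-- A coproduct of bounded distributive lattices is generated by the images of its components. -/
theorem mem_sublattice_of_forall_leg_mem {ι : Type w} {A : ι → 𝒜.FullSubcategory} {c : Cofan A}
    (hc : IsColimit ((forgetD τ 𝒜 hD).mapCocone c)) (K : Sublattice ((forgetD τ 𝒜 hD).obj c.pt))
    (hbot : ⊥ ∈ K) (htop : ⊤ ∈ K) (hK : ∀ i (a : (A i).obj), leg c i a ∈ K)
    (x : (forgetD τ 𝒜 hD).obj c.pt) : x ∈ K := by
  let _ : BoundedOrder K := Subtype.boundedOrder hbot htop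
  let g : ∀ i, BoundedLatticeHom ((forgetD τ 𝒜 hD).obj (A i)) K := fun i =>
    { toFun := fun a => ⟨leg c i a, hK i a⟩
      map_sup' := fun a b => Subtype.ext (SupHomClass.map_sup (redHom hD (leg c i)) a b)
      map_inf' := fun a b => Subtype.ext (InfHomClass.map_inf (redHom hD (leg c i)) a b)
      map_top' := Subtype.ext (TopHomClass.map_top (redHom hD (leg c i)))
      map_bot' := Subtype.ext (BotHomClass.map_bot (redHom hD (leg c i))) }
  obtain ⟨h, hh⟩ := exists_boundedLatticeHom_leg hc g
  let incl : BoundedLatticeHom K ((forgetD τ 𝒜 hD).obj c.pt) :=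
    { toFun := Subtype.val, map_sup' := fun _ _ => rfl, map_inf' := fun _ _ => rfl,
      map_top' := rfl, map_bot' := rfl }
  -- The inclusion of `K` is split by `h`, as both sides agree on the components.
  have hid : incl.comp h = BoundedLatticeHom.id _ :=
    boundedLatticeHom_ext_leg hc fun i a => congrArg Subtype.val (hh i a)
  have hx : ((h x : K) : (forgetD τ 𝒜 hD).obj c.pt) = x := DFunLike.congr_fun hid x
  exact hx ▸ (h x).2

/-- The forgetful functor preserves a coproduct if the images of the components generate its reduct
and every family of homomorphisms to `2` extends to it. -/
theorem nonempty_isColimit_mapCocone {ι : Type w} {A : ι → 𝒜.FullSubcategory} (c : Cofan A)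
    (hgen : ∀ K : Sublattice ((forgetD τ 𝒜 hD).obj c.pt), ⊥ ∈ K → ⊤ ∈ K →
      (∀ i (a : (A i).obj), leg c i a ∈ K) → ∀ x, x ∈ K)
    (hext : ∀ φ : ∀ i, BoundedLatticeHom ((forgetD τ 𝒜 hD).obj (A i)) Bool,
      ∃ ψ : BoundedLatticeHom ((forgetD τ 𝒜 hD).obj c.pt) Bool, ∀ i (a : (A i).obj),
        ψ (leg c i a) = φ i a) :
    Nonempty (IsColimit ((forgetD τ 𝒜 hD).mapCocone c)) := by
  have hex := fun s : Cocone (Discrete.functor A ⋙ forgetD τ 𝒜 hD) =>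
    existsUnique_boundedLatticeHom_extending (fun i => redHom hD (leg c i)) hgen hext
      fun i => (show BoundedLatticeHom ((forgetD τ 𝒜 hD).obj (A i)) s.pt from (s.ι.app ⟨i⟩).hom)
  choose d hd hd' using hex
  exact ⟨{
    desc := fun s => BddDistLat.ofHom (X := (forgetD τ 𝒜 hD).obj c.pt) (Y := s.pt) (d s)
    fac := fun s ⟨i⟩ => ConcreteCategory.hom_ext _ _ fun a => hd s i a
    uniq := fun s m hm => by
      have : m.hom = d s := hd' s m.hom fun i a =>
        (ConcreteCategory.comp_apply _ _ _).symm.trans (ConcreteCategory.congr_hom (hm ⟨i⟩) a)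
      exact BddDistLat.hom_ext this }⟩

variable [L.IsAlgebraic]

/-! ### From preservation of coproducts to a separating homomorphism and top subalgebras -/

/-- The algebra is a coproduct of the generators `M`, each taken once for every homomorphism `φ` from
its reduct to `2`, and `ω` extends all these `φ` simultaneously. -/
theorem exists_sep_of_preservesCoproducts (hfg : IsFinitelyGeneratedQuasivariety 𝒜)
    (hP : PreservesCoproducts.{w} (forgetD τ 𝒜 hD)) :
    ∃ (M : 𝒜.FullSubcategory) (ω : BoundedLatticeHom ((forgetD τ 𝒜 hD).obj M) Bool),
      Finite M.obj ∧ 𝒜 = ISP {M.obj} ∧ Sep M.obj (fun a : M.obj => ω a) := by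
  obtain ⟨𝓜, hfin, hM𝓜, h𝒜⟩ := hfg
  obtain ⟨n, M, hM⟩ : ∃ (n : ℕ) (M : Fin n → Alg.{u, v, w} L), Set.range M = 𝓜 := by
    obtain ⟨n, M, hM⟩ := hfin.fin_embedding
    exact ⟨n, M, hM⟩
  let B : Fin n → 𝒜.FullSubcategory := fun j =>
    ⟨M j, mem_of_mem_generators h𝒜 (hM ▸ ⟨j, rfl⟩)⟩
  have hBfin : ∀ j, Finite (B j).obj := fun j => hM𝓜 _ (hM ▸ ⟨j, rfl⟩)
  let ι : Type w := Σ j : Fin n, BoundedLatticeHom ((forgetD τ 𝒜 hD).obj (B j)) Bool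
  have hι : Finite ι := by
    have : ∀ j, Finite ((forgetD τ 𝒜 hD).obj (B j)) := hBfin
    have : ∀ j, Finite (BoundedLatticeHom ((forgetD τ 𝒜 hD).obj (B j)) Bool) :=
      fun j => DFunLike.finite _
    exact inferInstanceAs (Finite (Σ j : Fin n, _))
  obtain ⟨c, ⟨hc⟩, hcfin⟩ := exists_isColimit_cofan h𝒜 hfin hM𝓜 fun p : ι => B p.1
  have := hP ι
  obtain ⟨ω, hω⟩ := exists_boolHom_leg (isColimitOfPreserves (forgetD τ 𝒜 hD) hc)
    fun p : ι => p.2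
  have hsep : ∀ A : Alg.{u, v, w} L, 𝒜 A → ∀ a b : A,
      (∀ x : A →[L] c.pt.obj, ω (x a) = ω (x b)) → a = b := by
    intro A hA a b h
    refine ISP_iff.1 (h𝒜.le _ hA) a b ?_
    intro N hN y
    obtain ⟨j, rfl⟩ := hM.symm ▸ hN
    by_contra hne
    obtain ⟨φ, hφ⟩ := exists_boolHom_ne (D := (forgetD τ 𝒜 hD).obj (B j)) hne
    have := h ((leg c (⟨j, φ⟩ : ι)).comp y)
    exact hφ ((hω ⟨j, φ⟩ (y a)).symm.trans (this.trans (hω ⟨j, φ⟩ (y b))))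
  exact ⟨c.pt, ω, hcfin hι fun p => hBfin p.1, eq_ISP_singleton h𝒜 c.pt.property
    fun A hA a b h => hsep A hA a b fun x => congrArg ω (h x), fun a b => hsep _ c.pt.property a b⟩

/-- The top element is the image of the coproduct of all the subalgebras contained in `K`. -/
theorem hasTop_of_preservesCoproducts (hfg : IsFinitelyGeneratedQuasivariety 𝒜)
    (hP : PreservesCoproducts.{w} (forgetD τ 𝒜 hD)) (A : 𝒜.FullSubcategory)
    (K : Sublattice ((forgetD τ 𝒜 hD).obj A)) (hbot : ⊥ ∈ K) (htop : ⊤ ∈ K) :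
    HasTop {C : L.Substructure A.obj | ∀ c : A.obj, c ∈ C → c ∈ K} := by
  obtain ⟨𝓜, hfin, hM𝓜, h𝒜⟩ := hfg
  let ι : Type w := {C : L.Substructure A.obj // ∀ c : A.obj, c ∈ C → c ∈ K}
  obtain ⟨c, ⟨hc⟩, -⟩ := exists_isColimit_cofan h𝒜 hfin hM𝓜 fun C : ι =>
    ⟨⟨C.1⟩, mem_substructure h𝒜 A.property C.1⟩
  have := hP ι
  have hUc := isColimitOfPreserves (forgetD τ 𝒜 hD) hc
  obtain ⟨h, hh⟩ := exists_hom_leg hc (B := A) fun C : ι => C.1.subtype.toHom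
  refine ⟨h.range, ?_, fun C hC a ha => ?_⟩
  · rintro _ ⟨x, rfl⟩
    refine mem_sublattice_of_forall_leg_mem hUc
      (K.comap (redHom hD (A := c.pt) (B := A) h : LatticeHom _ _)) ?_ ?_ ?_ x
    · change redHom hD (A := c.pt) (B := A) h ⊥ ∈ K
      rwa [BotHomClass.map_bot]
    · change redHom hD (A := c.pt) (B := A) h ⊤ ∈ K
      rwa [TopHomClass.map_top]
    · intro C a
      change h (leg c C a) ∈ K
      rw [hh C a]
      exact C.2 _ a.2
  · exact ⟨_, hh ⟨C, hC⟩ ⟨a, ha⟩⟩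

/-! ### From a generating algebra to a relatively subdirectly irreducible one -/

/-- A pair `(M, ω)` with `M` generating and separation, and with `M` of least cardinality, has `M`
relatively subdirectly irreducible: in a subdirect decomposition of `M`, the homomorphism `ω`
factors through some component, which then is generating and separated as well. -/
theorem exists_isRelSI_sep
    (h : ∃ (M : 𝒜.FullSubcategory) (ω : BoundedLatticeHom ((forgetD τ 𝒜 hD).obj M) Bool),
      Finite M.obj ∧ 𝒜 = ISP {M.obj} ∧ Sep M.obj (fun a : M.obj => ω a)) :
    ∃ (M : 𝒜.FullSubcategory) (ω : BoundedLatticeHom ((forgetD τ 𝒜 hD).obj M) Bool),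
      Finite M.obj ∧ 𝒜 = ISP {M.obj} ∧ Sep M.obj (fun a : M.obj => ω a) ∧
      IsRelSI 𝒜 M.obj := by
  classical
  have hn : ∃ (n : ℕ) (M : 𝒜.FullSubcategory)
      (ω : BoundedLatticeHom ((forgetD τ 𝒜 hD).obj M) Bool),
      Nat.card M.obj = n ∧ Finite M.obj ∧ 𝒜 = ISP {M.obj} ∧
        Sep M.obj (fun a : M.obj => ω a) := by
    obtain ⟨M, ω, hM⟩ := h
    exact ⟨_, M, ω, rfl, hM⟩
  obtain ⟨M, ω, hcard, hfin, h𝒜, hω⟩ := Nat.find_spec hn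
  refine ⟨M, ω, hfin, h𝒜, hω, M.property, fun ι C hC f hf => ?_⟩
  let B : ι → 𝒜.FullSubcategory := fun i => ⟨C i, hC i⟩
  let g : ∀ i, M.obj →[L] (B i).obj := fun i => (piEval i).comp f.toHom
  have : Finite ((forgetD τ 𝒜 hD).obj M) := hfin
  have := Fintype.ofFinite ((forgetD τ 𝒜 hD).obj M)
  obtain ⟨_, ⟨⟨i, ψ⟩, rfl⟩, hψ⟩ := exists_mem_forall_eq_of_separating
    (Y := Set.range fun p : Σ i, BoundedLatticeHom ((forgetD τ 𝒜 hD).obj (B i)) Bool =>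
      p.2.comp (redHom hD (g p.1)))
    (fun a b hab => f.injective (funext fun i => by
      by_contra hne
      obtain ⟨ψ, hψ⟩ := exists_boolHom_ne (D := (forgetD τ 𝒜 hD).obj (B i)) hne
      exact hψ (hab _ ⟨⟨i, ψ⟩, rfl⟩))) ω Finset.univ
  have hψ' : ∀ a : M.obj, ψ (g i a) = ω a := fun a => hψ a (Finset.mem_univ _)
  have hsep : ∀ A : Alg.{u, v, w} L, 𝒜 A → ∀ a b : A,
      (∀ x : A →[L] C i, ψ (x a) = ψ (x b)) → a = b := by
    intro A hA a b hab
    refine hω.eq_of_forall (h𝒜.le _ hA) fun x => ?_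
    exact (hψ' (x a)).symm.trans ((hab ((g i).comp x)).trans (hψ' (x b)))
  have hCfin : Finite (C i) := Finite.of_surjective _ (hf i)
  have hle : Nat.card M.obj ≤ Nat.card (C i) := by
    rw [hcard]
    exact Nat.find_min' hn ⟨B i, ψ, rfl, hCfin, eq_ISP_singleton h𝒜 (hC i)
      fun A hA a b hab => hsep A hA a b fun x => congrArg ψ (hab x), fun a b => hsep _ (hC i) a b⟩
  refine ⟨i, nonempty_equiv_of_bijective (g i) ?_⟩
  exact (Nat.bijective_iff_surjective_and_card (g i)).2
    ⟨hf i, le_antisymm hle (Nat.card_le_card_of_surjective _ (hf i))⟩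

/-- The pairs `(c₁, c₂)` with `ω c₁ ≤ ω c₂` form a bounded sublattice of the reduct of `M²`, and it
contains a subalgebra, the diagonal. -/
theorem hasTop_compatible_of_hasTop (M : 𝒜.FullSubcategory)
    (ω : BoundedLatticeHom ((forgetD τ 𝒜 hD).obj M) Bool) {𝓜 : Set (Alg.{u, v, w} L)}
    (h𝒜 : 𝒜 = ISP 𝓜)
    (htop : ∀ (A : 𝒜.FullSubcategory) (K : Sublattice ((forgetD τ 𝒜 hD).obj A)),
      ⊥ ∈ K → ⊤ ∈ K →
        {C : L.Substructure A.obj | ∀ c : A.obj, c ∈ C → c ∈ K} = ∅ ∨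
        HasTop {C : L.Substructure A.obj | ∀ c : A.obj, c ∈ C → c ∈ K}) :
    HasTop {C : L.Substructure (M.obj × M.obj) |
      ∀ c : M.obj × M.obj, c ∈ C → ω c.1 ≤ ω c.2} := by
  let A : 𝒜.FullSubcategory := ⟨⟨M.obj × M.obj⟩, mem_prod h𝒜 M.property M.property⟩
  let φ : BoundedLatticeHom ((forgetD τ 𝒜 hD).obj A) Bool :=
    ω.comp (redHom hD (A := A) (B := M) fstHom)
  let ψ : BoundedLatticeHom ((forgetD τ 𝒜 hD).obj A) Bool :=
    ω.comp (redHom hD (A := A) (B := M) sndHom)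
  let K : Sublattice ((forgetD τ 𝒜 hD).obj A) :=
    { carrier := {c | φ c ≤ ψ c}
      supClosed' := fun a ha b hb => by
        simp only [Set.mem_ofPred_eq, SupHomClass.map_sup] at ha hb ⊢
        exact sup_le_sup ha hb
      infClosed' := fun a ha b hb => by
        simp only [Set.mem_ofPred_eq, InfHomClass.map_inf] at ha hb ⊢
        exact inf_le_inf ha hb }
  refine (htop A K ?_ ?_).resolve_left fun hempty => ?_
  · change φ ⊥ ≤ ψ ⊥
    simp only [BotHomClass.map_bot, le_refl]
  · change φ ⊤ ≤ ψ ⊤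
    simp only [TopHomClass.map_top, le_refl]
  · refine Set.eq_empty_iff_forall_notMem.1 hempty
      (pairHom (Hom.id L M.obj) (Hom.id L M.obj)).range ?_
    rintro _ ⟨m, rfl⟩
    exact le_refl (ω m)

/-- An algebra into which all relatively subdirectly irreducible ones embed generates `𝒜`. -/
theorem eq_ISP_of_isRelSI (hfg : IsFinitelyGeneratedQuasivariety 𝒜) {M : Alg.{u, v, w} L}
    (hM : 𝒜 M)
    (hIS : ∀ B : Alg.{u, v, w} L, IsRelSI 𝒜 B → opI (opS (fun N => N = M)) B) : 𝒜 = ISP {M} := by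
  obtain ⟨𝓜, -, hM𝓜, h𝒜⟩ := hfg
  have hSI : ∀ B : Alg.{u, v, w} L, IsRelSI 𝒜 B → ISP {M} B := fun B hB => by
    obtain ⟨_, ⟨_, rfl, C, rfl⟩, ⟨e⟩⟩ := hIS B hB
    exact ISP_iff.2 fun a b h =>
      e.injective (C.subtype.injective (h _ rfl (C.subtype.toHom.comp e.toHom)))
  refine eq_ISP_singleton h𝒜 hM fun A hA a b h => ISP_iff.1 (h𝒜.le _ hA) a b fun N hN x => ?_
  have := hM𝓜 N hN
  refine ISP_iff.1 (ISP_of_finite_of_isRelSI hSI N (mem_of_mem_generators h𝒜 hN)) _ _ ?_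
  rintro _ rfl y
  exact h (y.comp x)

/-! ### From the top compatible subalgebra of `M²` to preservation of coproducts -/

/-- By separation, all homomorphisms from reducts to `2` are of the form `ω ∘ x`. Hence they extend
to a coproduct. The images of the components also generate its reduct: otherwise two homomorphisms
`ω ∘ y` and `ω ∘ z` are comparable on the sublattice generated by the images but not on the whole
coproduct, which the top compatible subalgebra of `M²` rules out. -/
theorem preservesCoproducts_of_sep_of_hasTop (M : 𝒜.FullSubcategory)
    (ω : BoundedLatticeHom ((forgetD τ 𝒜 hD).obj M) Bool) [Finite M.obj]
    (h𝒜 : 𝒜 = ISP {M.obj}) (hω : Sep M.obj (fun a : M.obj => ω a))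
    (htop : HasTop {C : L.Substructure (M.obj × M.obj) |
      ∀ c : M.obj × M.obj, c ∈ C → ω c.1 ≤ ω c.2}) :
    PreservesCoproducts.{w} (forgetD τ 𝒜 hD) := by
  intro ι
  have hrep : ∀ (A : 𝒜.FullSubcategory) (φ : BoundedLatticeHom ((forgetD τ 𝒜 hD).obj A) Bool),
      ∃ x : A.obj →[L] M.obj, ∀ a : A.obj, ω (x a) = φ a := fun A φ =>
    exists_hom_of_boolHom ω (fun a b => hω.eq_of_forall (h𝒜.le _ A.property)) φ
  have (A : ι → 𝒜.FullSubcategory) : PreservesColimit (Discrete.functor A) (forgetD τ 𝒜 hD) := by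
    refine ⟨fun {c} hc => nonempty_isColimit_mapCocone c (fun K hbot htop' hK x => ?_) fun φ => ?_⟩
    · by_contra hx
      obtain ⟨φ, ψ, hle, hφ, hψ⟩ := exists_boolHom_of_notMem hbot htop' hx
      obtain ⟨y, hy⟩ := hrep c.pt φ
      obtain ⟨z, hz⟩ := hrep c.pt ψ
      have := le_of_hasTop (ω := fun a => ω a) htop (leg c) (mem_of_forall_leg_mem h𝒜 hc) y z
        (fun i a => by
          rw [hy, hz]
          exact hle _ (hK i a)) x
      rw [show ω (y x) = true from (hy x).trans hφ, show ω (z x) = false from (hz x).trans hψ]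
        at this
      exact absurd this (by decide)
    · choose x hx using fun i => hrep (A i) (φ i)
      obtain ⟨h, hh⟩ := exists_hom_leg hc (B := M) x
      refine ⟨ω.comp (redHom hD h), fun i a => ?_⟩
      exact (congrArg ω (hh i a)).trans (hx i a)
  exact preservesColimitsOfShape_of_discrete (forgetD τ 𝒜 hD)

end Preservation

end CoprodPres

/-! ### The equivalence -/

theorem theorem3p6 {L : FirstOrder.Language.{u, v}} [L.IsAlgebraic] (τ : CoprodPres.LatticeTerms L)
    (𝒜 : ObjectProperty (CoprodPres.Alg.{u, v, w} L))
    (hfg : CoprodPres.IsFinitelyGeneratedQuasivariety 𝒜)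
    (hD : CoprodPres.IsDBased τ 𝒜) :
    List.TFAE [
      -- `U` preserves coproducts
      CoprodPres.PreservesCoproducts.{w} (CoprodPres.forgetD τ 𝒜 hD),
      -- generation by one finite algebra with `Sep`, and tops of subalgebras inside sublattices
      (∃ (M : 𝒜.FullSubcategory)
          (ω : BoundedLatticeHom ((CoprodPres.forgetD τ 𝒜 hD).obj M) Bool),
        Finite M.obj ∧ 𝒜 = CoprodPres.ISP {M.obj} ∧
        CoprodPres.Sep M.obj (fun a : M.obj => ω a)) ∧
      (∀ (A : 𝒜.FullSubcategory) (K : Sublattice ((CoprodPres.forgetD τ 𝒜 hD).obj A)),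
        ⊥ ∈ K → ⊤ ∈ K →
          {C : L.Substructure A.obj | ∀ c : A.obj, c ∈ C → c ∈ K} = ∅ ∨
          CoprodPres.HasTop {C : L.Substructure A.obj | ∀ c : A.obj, c ∈ C → c ∈ K}),
      -- the finitely checkable condition on one relatively subdirectly irreducible algebra
      (∃ (M : 𝒜.FullSubcategory)
          (ω : BoundedLatticeHom ((CoprodPres.forgetD τ 𝒜 hD).obj M) Bool),
        Finite M.obj ∧ CoprodPres.IsRelSI 𝒜 M.obj ∧
        (∀ B : CoprodPres.Alg.{u, v, w} L, CoprodPres.IsRelSI 𝒜 B →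
          CoprodPres.opI (CoprodPres.opS (fun N => N = M.obj)) B) ∧
        CoprodPres.Sep M.obj (fun a : M.obj => ω a) ∧
        CoprodPres.HasTop {C : L.Substructure (M.obj × M.obj) |
          ∀ c : M.obj × M.obj, c ∈ C → ω c.1 ≤ ω c.2})] := by
  tfae_have 1 → 2 := fun hP =>
    ⟨CoprodPres.exists_sep_of_preservesCoproducts hfg hP, fun A K hbot htop =>
      Or.inr (CoprodPres.hasTop_of_preservesCoproducts hfg hP A K hbot htop)⟩
  tfae_have 2 → 3 := by
    rintro ⟨h, htop⟩
    obtain ⟨M, ω, hfin, h𝒜, hω, hSI⟩ := CoprodPres.exists_isRelSI_sep h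
    refine ⟨M, ω, hfin, hSI, fun B hB => ?_, hω, ?_⟩
    · obtain ⟨_, rfl, x, hx⟩ := hB.exists_injective h𝒜
      exact ⟨_, ⟨_, rfl, _, rfl⟩,
        ⟨(FirstOrder.Language.Embedding.ofInjective (L := L) hx).equivRange⟩⟩
    · exact CoprodPres.hasTop_compatible_of_hasTop M ω h𝒜 htop
  tfae_have 3 → 1 := by
    rintro ⟨M, ω, hfin, hSI, hIS, hω, htop⟩
    exact CoprodPres.preservesCoproducts_of_sep_of_hasTop M ω
      (CoprodPres.eq_ISP_of_isRelSI hfg M.property hIS) hω htop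
  tfae_finish
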